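/- Let $k\ge 1$ and let $x_1,\dots,x_{k+1}\in\mathbb C$ be pairwise distinct nodes. Put $\gamma_j(\lambda)=\lambda-x_j$, $\ell(\lambda)=\prod_{i=1}^{k+1}(\lambda-x_i)$ and $w_i=\prod_{j\ne i}(x_i-x_j)^{-1}$, let $P_1,\dots,P_{k+1}\in\mathbb C^{m\times n}$, and let $$P(\lambda)=\ell(\lambda)\sum_{i=1}^{k+1}P_i\,\frac{w_i}{\gamma_i(\lambda)},$$ regarded as an $m\times n$ matrix polynomial of grade $k$. Let $0\le\mu\le k-1$ be an integer and define the following block-bidiagonal pencils, with $k-\mu-1$ and $\mu$ block rows respectively: $$K_1^L(\lambda)=\begin{bmatrix}\gamma_{k+1}I_n&-\gamma_{k-1}I_n&&\\&\gamma_kI_n&-\gamma_{k-2}I_n&\\&&\ddots&\ddots\\&&&\gamma_{\mu+3}I_n&-\gamma_{\mu+1}I_n\end{bmatrix},$$ $$K_2^L(\lambda)=\begin{bmatrix}\gamma_{\mu+2}I_m&-\gamma_{\mu}I_m&&\\&\gamma_{\mu+1}I_m&-\gamma_{\mu-1}I_m&\\&&\ddots&\ddots\\&&&\gamma_{3}I_m&-\gamma_{1}I_m\end{bmatrix}$$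 ($K_1^L$ is empty, i.e. has no rows, if $\mu=k-1$, and so is $K_2^L$ if $\mu=0$). Let $M_\mu^L(\lambda)$ be the pencil with $\mu+1$ block rows and $k-\mu$ block columns, with blocks of size $m\times n$, whose first block row is $$\begin{bmatrix}P_{k+1}w_{k+1}\gamma_k+P_kw_k\gamma_{k+1}&P_{k-1}w_{k-1}\gamma_k&P_{k-2}w_{k-2}\gamma_{k-1}&\cdots&P_{\mu+1}w_{\mu+1}\gamma_{\mu+2}\end{bmatrix}$$ (only its first block if $\mu=k-1$), whose last block column has, below the first block row, the blocks $P_\mu w_\mu\gamma_{\mu+1},\dots,P_2w_2\gamma_3,P_1w_1\gamma_2$, and whose other blocks are zero. Then the colleague Lagrange pencil $$L_P^\mu(\lambda)=\begin{bmatrix}M_\mu^L(\lambda)&K_2^L(\lambda)^T\\K_1^L(\lambda)&0\end{bmatrix}$$ is a strong linearization of $P(\lambda)$. More generally, for all constant matrices $A\in\mathbb C^{(\mu+1)m\times(k-\mu-1)n}$ and $B\in\mathbb C^{\mu m\times(k-\mu)n}$, the pencil $$L(\lambda)=\begin{bmatrix}M_\mu^L(\lambda)+AK_1^L(\lambda)+K_2^L(\lambda)^TB&K_2^L(\lambda)^T\\K_1^L(\lambda)&0\end{bmatrix}$$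 is a strong linearization of $P(\lambda)$. Here a pencil $L(\lambda)$ is a linearization of a matrix polynomial $Q(\lambda)$ if $U(\lambda)L(\lambda)V(\lambda)=\operatorname{diag}(I_s,Q(\lambda))$ for some integer $s\ge 0$ and some unimodular matrix polynomials $U,V$ (determinant a nonzero constant). It is a strong linearization of $P(\lambda)$, of grade $k$, if moreover $\operatorname{rev}_1L(\lambda)=\lambda L(1/\lambda)$ is a linearization of $\operatorname{rev}_kP(\lambda)=\lambda^kP(1/\lambda)$. -/

import Mathlib

open Polynomial
open scoped Kronecker

noncomputable section

/-! Matrix polynomials are matrices with entries in `ℂ[X]`. -/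

/-- A square matrix polynomial is unimodular if its determinant is a nonzero constant. -/
def IsUnimodular {ι : Type*} [Fintype ι] [DecidableEq ι] (U : Matrix ι ι ℂ[X]) : Prop :=
  ∃ c : ℂ, c ≠ 0 ∧ U.det = C c

/-- `P` has grade `d`: every entry has degree at most `d`. -/
def HasGrade {α β : Type*} (d : ℕ) (P : Matrix α β ℂ[X]) : Prop :=
  ∀ i j, (P i j).degree ≤ (d : WithBot ℕ)

/-- The reversal `λ ^ d * P(1/λ)` of a matrix polynomial of grade `d`: the coefficients of `λ ^ i`
and `λ ^ (d - i)` are exchanged in every entry. -/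
def matrixRev {α β : Type*} (d : ℕ) (P : Matrix α β ℂ[X]) : Matrix α β ℂ[X] :=
  P.map (Polynomial.reflect d)

/-- The pencil `L` is a linearization of the `m × n` matrix polynomial `P`:
`U * L * V = diag(I_s, P)` for some `s` and unimodular `U`, `V`. The bijections `eR`, `eC` only
number the rows and columns of `L`, whose index types are arbitrary. The size of `L` determines
`s`; the trivial value `s = 0` (a pencil of the same size as `P`) is allowed. -/
def IsLinearization {α β : Type*} {m n : ℕ} (L : Matrix α β ℂ[X])
    (P : Matrix (Fin m) (Fin n) ℂ[X]) : Prop :=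
  HasGrade 1 L ∧
    ∃ (s : ℕ) (eR : α ≃ Fin s ⊕ Fin m) (eC : β ≃ Fin s ⊕ Fin n)
      (U : Matrix (Fin s ⊕ Fin m) (Fin s ⊕ Fin m) ℂ[X])
      (V : Matrix (Fin s ⊕ Fin n) (Fin s ⊕ Fin n) ℂ[X]),
      IsUnimodular U ∧ IsUnimodular V ∧
        U * Matrix.reindex eR eC L * V = Matrix.fromBlocks 1 0 0 P

/-- `L` is a strong linearization of `P`, regarded as a matrix polynomial of grade `k`. -/
def IsStrongLinearization {α β : Type*} {m n : ℕ} (k : ℕ) (L : Matrix α β ℂ[X])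
    (P : Matrix (Fin m) (Fin n) ℂ[X]) : Prop :=
  HasGrade k P ∧ IsLinearization L P ∧ IsLinearization (matrixRev 1 L) (matrixRev k P)

namespace LagrangePencil

/-! The nodes are `x 1, …, x (k + 1)` and the coefficients `P 1, …, P (k + 1)`; the values of `x`
and `P` at other indices are never used. -/

/-- `γ_j(λ) = λ - x_j`. -/
def gam (x : ℕ → ℂ) (j : ℕ) : ℂ[X] := X - C (x j)

/-- `ℓ(λ) = (λ - x_1) ⋯ (λ - x_{k+1})`. -/
def ell (k : ℕ) (x : ℕ → ℂ) : ℂ[X] := ∏ j ∈ Finset.Icc 1 (k + 1), gam x j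

/-- The barycentric weight `w_i = 1 / ∏_{j ≠ i} (x_i - x_j)`. -/
def weight (k : ℕ) (x : ℕ → ℂ) (i : ℕ) : ℂ :=
  1 / ∏ j ∈ (Finset.Icc 1 (k + 1)).erase i, (x i - x j)

/-- The division `ℓ / γ_i` of polynomials is exact. -/
theorem ell_div_gam_mul (k : ℕ) (x : ℕ → ℂ) {i : ℕ} (hi : i ∈ Finset.Icc 1 (k + 1)) :
    ell k x / gam x i * gam x i = ell k x := by
  have h : gam x i ∣ ell k x := Finset.dvd_prod_of_mem _ hi
  rw [mul_comm]
  exact EuclideanDomain.mul_div_cancel' (X_sub_C_ne_zero _) h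

/-- The block `P_i w_i q(λ)`. -/
def scaledCoeff {m n : ℕ} (k : ℕ) (x : ℕ → ℂ) (P : ℕ → Matrix (Fin m) (Fin n) ℂ)
    (i : ℕ) (q : ℂ[X]) : Matrix (Fin m) (Fin n) ℂ[X] :=
  q • (weight k x i • P i).map C

/-- The matrix polynomial `P(λ) = ℓ(λ) ∑_{i=1}^{k+1} P_i w_i / γ_i(λ)`. -/
def barycentricPoly {m n : ℕ} (k : ℕ) (x : ℕ → ℂ) (P : ℕ → Matrix (Fin m) (Fin n) ℂ) :
    Matrix (Fin m) (Fin n) ℂ[X] :=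
  ∑ i ∈ Finset.Icc 1 (k + 1), scaledCoeff k x P i (ell k x / gam x i)

/-- `K_1(λ)`: block row `i` (counted from `0`) has `γ_{k+1-i} I_n` in block column `i` and
`-γ_{k-1-i} I_n` in block column `i + 1`. -/
def K₁ (k μ n : ℕ) (x : ℕ → ℂ) :
    Matrix (Fin (k - μ - 1) × Fin n) (Fin (k - μ) × Fin n) ℂ[X] :=
  (Matrix.of fun (i : Fin (k - μ - 1)) (j : Fin (k - μ)) =>
    if (j : ℕ) = i then gam x (k + 1 - i)
    else if (j : ℕ) = i + 1 then -gam x (k - 1 - i)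
    else 0) ⊗ₖ (1 : Matrix (Fin n) (Fin n) ℂ[X])

/-- `K_2(λ)`: block row `i` (counted from `0`) has `γ_{μ+2-i} I_m` in block column `i` and
`-γ_{μ-i} I_m` in block column `i + 1`. -/
def K₂ (μ m : ℕ) (x : ℕ → ℂ) :
    Matrix (Fin μ × Fin m) (Fin (μ + 1) × Fin m) ℂ[X] :=
  (Matrix.of fun (i : Fin μ) (j : Fin (μ + 1)) =>
    if (j : ℕ) = i then gam x (μ + 2 - i)
    else if (j : ℕ) = i + 1 then -gam x (μ - i)
    else 0) ⊗ₖ (1 : Matrix (Fin m) (Fin m) ℂ[X])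

/-- The `(r, c)` block of `M_μ(λ)`, with `r` and `c` counted from `0`: only the first block row and
the last block column are nonzero. -/
def bodyBlock {m n : ℕ} (k μ : ℕ) (x : ℕ → ℂ) (P : ℕ → Matrix (Fin m) (Fin n) ℂ) (r c : ℕ) :
    Matrix (Fin m) (Fin n) ℂ[X] :=
  if r = 0 then
    if c = 0 then
      scaledCoeff k x P (k + 1) (gam x k) + scaledCoeff k x P k (gam x (k + 1))
    else scaledCoeff k x P (k - c) (gam x (k + 1 - c))
  else if c + 1 = k - μ then scaledCoeff k x P (μ + 1 - r) (gam x (μ + 2 - r))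
  else 0

/-- The pencil `M_μ(λ)`, with `μ + 1` block rows and `k - μ` block columns. -/
def body {m n : ℕ} (k μ : ℕ) (x : ℕ → ℂ) (P : ℕ → Matrix (Fin m) (Fin n) ℂ) :
    Matrix (Fin (μ + 1) × Fin m) (Fin (k - μ) × Fin n) ℂ[X] :=
  Matrix.of fun p q => bodyBlock k μ x P p.1 q.1 p.2 q.2

/-- The Lagrange pencil `[M, K_2ᵀ; K_1, 0]` with body `M`. -/
def pencil {m n : ℕ} (k μ : ℕ) (x : ℕ → ℂ)
    (M : Matrix (Fin (μ + 1) × Fin m) (Fin (k - μ) × Fin n) ℂ[X]) :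
    Matrix ((Fin (μ + 1) × Fin m) ⊕ (Fin (k - μ - 1) × Fin n))
      ((Fin (k - μ) × Fin n) ⊕ (Fin μ × Fin m)) ℂ[X] :=
  Matrix.fromBlocks M (K₂ μ m x).transpose (K₁ k μ n x) 0

end LagrangePencil

end

/-! ### Unimodular completions and elimination in block pencils -/

noncomputable section

open Matrix

/-! Let `F₁`, `F₂` be polynomial bases of the right kernels of `K₁`, `K₂`. Both pencils extend to
unimodular matrices, and block elimination then reduces `[M, K₂ᵀ; K₁, 0]` to `diag(I, F₂ᵀ M F₁)`
(`isLinearization_fromBlocks`). The matrices `A K₁` and `K₂ᵀ B` do not change `F₂ᵀ M F₁`, so only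
two points remain.

Completion (`hasUnimodularCompletion_bidiagonal`): the kernel of a bidiagonal matrix is spanned by
products of its entries. Distinct nodes make these products generate the unit ideal, and a Bézout
row completes the matrix. Reversal replaces `λ - x_j` by `1 - x_j λ`, which preserves the required
coprimality. Since the grades of `F₂`, `M`, `F₁` add up to `k`, reversal commutes with the
contraction, so the same argument gives strongness.

Contraction (`kernel_mul_body_mul_kernel`): at each nonzero block of the body, the product of the
two kernel entries is `ℓ` without two factors `γ`. Each summand of the block restores one of them,
leaving the barycentric term `ℓ / γ_i`. -/

/-- The matrix `K` with right kernel `F` completes to a pair of mutually inverse matrices `[K; G]`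
and `[S, F]`. -/
def HasUnimodularCompletion {R ρ κ ν : Type*} [CommRing R] [Fintype ρ] [Fintype κ] [Fintype ν]
    [DecidableEq ρ] [DecidableEq κ] [DecidableEq ν] (K : Matrix ρ κ R) (F : Matrix κ ν R) : Prop :=
  ∃ (G : Matrix ν κ R) (S : Matrix κ ρ R),
    K * S = 1 ∧ K * F = 0 ∧ G * S = 0 ∧ G * F = 1 ∧ S * K + F * G = 1

namespace HasUnimodularCompletion

variable {R ρ κ ν : Type*} [CommRing R] [Fintype ρ] [Fintype κ] [Fintype ν]
    [DecidableEq ρ] [DecidableEq κ] [DecidableEq ν] {K : Matrix ρ κ R} {F : Matrix κ ν R}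

theorem kronecker_one (h : HasUnimodularCompletion K F) (ι : Type*) [Fintype ι] [DecidableEq ι] :
    HasUnimodularCompletion (K ⊗ₖ (1 : Matrix ι ι R)) (F ⊗ₖ (1 : Matrix ι ι R)) := by
  obtain ⟨G, S, h1, h2, h3, h4, h5⟩ := h
  refine ⟨G ⊗ₖ 1, S ⊗ₖ 1, ?_, ?_, ?_, ?_, ?_⟩
  · rw [← mul_kronecker_mul, h1, one_mul, one_kronecker_one]
  · rw [← mul_kronecker_mul, h2, zero_kronecker]
  · rw [← mul_kronecker_mul, h3, zero_kronecker]
  · rw [← mul_kronecker_mul, h4, one_mul, one_kronecker_one]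
  · rw [← mul_kronecker_mul, ← mul_kronecker_mul, ← add_kronecker, h5, one_mul, one_kronecker_one]

theorem reindex_right {ν' : Type*} [Fintype ν'] [DecidableEq ν']
    (h : HasUnimodularCompletion K F) (e : ν' ≃ ν) :
    HasUnimodularCompletion K (F.submatrix id e) := by
  obtain ⟨G, S, h1, h2, h3, h4, h5⟩ := h
  refine ⟨G.submatrix e id, S, h1, ?_, ?_, ?_, ?_⟩
  · ext i j
    exact congrFun (congrFun h2 i) (e j)
  · ext i j
    exact congrFun (congrFun h3 (e i)) j
  · have : G.submatrix e id * F.submatrix id e = (G * F).submatrix e e := rfl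
    rw [this, h4, submatrix_one_equiv]
  · rw [submatrix_mul_equiv, submatrix_id_id, h5]

end HasUnimodularCompletion

theorem isUnimodular_of_mul_eq_one {ι : Type*} [Fintype ι] [DecidableEq ι]
    {U V : Matrix ι ι ℂ[X]} (h : U * V = 1) : IsUnimodular U := by
  have h1 : IsUnit U.det := (Matrix.isUnit_iff_isUnit_det U).1 (IsUnit.of_mul_eq_one V h)
  obtain ⟨c, hc, h2⟩ := Polynomial.isUnit_iff.1 h1
  exact ⟨c, hc.ne_zero, h2.symm⟩

/-- Linearizations may be tested with invertible matrices whose rows and columns are indexed by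
different types. -/
theorem isLinearization_of_mul_mul_eq {α β σ : Type*} [Fintype α] [Fintype β] [Fintype σ]
    [DecidableEq α] [DecidableEq β] [DecidableEq σ] {m n : ℕ}
    {L : Matrix α β ℂ[X]} {P : Matrix (Fin m) (Fin n) ℂ[X]} (hL : HasGrade 1 L)
    {U : Matrix (σ ⊕ Fin m) α ℂ[X]} {U' : Matrix α (σ ⊕ Fin m) ℂ[X]}
    {V : Matrix β (σ ⊕ Fin n) ℂ[X]} {V' : Matrix (σ ⊕ Fin n) β ℂ[X]}
    (hU : U * U' = 1) (hU' : U' * U = 1) (hV : V * V' = 1) (hV' : V' * V = 1)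
    (h : U * L * V = fromBlocks 1 0 0 P) : IsLinearization L P := by
  have cα : Fintype.card α = Fintype.card (σ ⊕ Fin m) := square_of_invertible U' U hU' hU
  have cβ : Fintype.card β = Fintype.card (σ ⊕ Fin n) := square_of_invertible V V' hV hV'
  have e : σ ≃ Fin (Fintype.card σ) := Fintype.equivFin σ
  let em := Equiv.sumCongr e (Equiv.refl (Fin m))
  let en := Equiv.sumCongr e (Equiv.refl (Fin n))
  let eR := (Fintype.equivOfCardEq cα).trans em
  let eC := (Fintype.equivOfCardEq cβ).trans en
  refine ⟨hL, Fintype.card σ, eR, eC, U.submatrix em.symm eR.symm, V.submatrix eC.symm en.symm,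
    isUnimodular_of_mul_eq_one (V := U'.submatrix eR.symm em.symm) ?_,
    isUnimodular_of_mul_eq_one (V := V'.submatrix en.symm eC.symm) ?_, ?_⟩
  · rw [submatrix_mul_equiv, hU, submatrix_one_equiv]
  · rw [submatrix_mul_equiv, hV, submatrix_one_equiv]
  · rw [reindex_apply, submatrix_mul_equiv, submatrix_mul_equiv, h]
    ext (i | i) (j | j) <;> simp [em, en, one_apply]

/-- In the coordinates given by the completions, `K` becomes `[I, 0]` and `K'ᵀ` becomes `[I; 0]`.
These identity blocks clear every block of `M` except the one between the two kernels. -/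
theorem isLinearization_fromBlocks {ρ₁ κ₁ ρ₂ κ₂ : Type*} [Fintype ρ₁] [Fintype κ₁] [Fintype ρ₂]
    [Fintype κ₂] [DecidableEq ρ₁] [DecidableEq κ₁] [DecidableEq ρ₂] [DecidableEq κ₂] {m n : ℕ}
    {K : Matrix ρ₁ κ₁ ℂ[X]} {F : Matrix κ₁ (Fin n) ℂ[X]}
    {K' : Matrix ρ₂ κ₂ ℂ[X]} {F' : Matrix κ₂ (Fin m) ℂ[X]} (M : Matrix κ₂ κ₁ ℂ[X])
    (h : HasUnimodularCompletion K F) (h' : HasUnimodularCompletion K' F')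
    (hL : HasGrade 1 (fromBlocks M K'ᵀ K 0)) :
    IsLinearization (fromBlocks M K'ᵀ K 0) (F'ᵀ * M * F) := by
  obtain ⟨G, S, h1, h2, h3, h4, h5⟩ := h
  obtain ⟨G', S', t1, t2, t3, t4, t5⟩ := h'
  replace t1 : S'ᵀ * K'ᵀ = 1 := by rw [← transpose_mul, t1, transpose_one]
  replace t2 : F'ᵀ * K'ᵀ = 0 := by rw [← transpose_mul, t2, transpose_zero]
  replace t3 : S'ᵀ * G'ᵀ = 0 := by rw [← transpose_mul, t3, transpose_zero]
  replace t4 : F'ᵀ * G'ᵀ = 1 := by rw [← transpose_mul, t4, transpose_one]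
  replace t5 : K'ᵀ * S'ᵀ + G'ᵀ * F'ᵀ = 1 := by
    rw [← transpose_mul, ← transpose_mul, ← transpose_add, t5, transpose_one]
  -- The entry `-(F'ᵀ * M * S)` of `U` is the row operation using `K * S = 1`; the entries `-(S'ᵀ *
  -- M * S)` and `-(S'ᵀ * M * F)` of `V` are the column operations using `S'ᵀ * K'ᵀ = 1`.
  refine isLinearization_of_mul_mul_eq (σ := ρ₁ ⊕ ρ₂) hL
    (U := fromBlocks (fromRows 0 S'ᵀ) (fromRows 1 0) F'ᵀ (-(F'ᵀ * M * S)))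
    (U' := fromBlocks (fromCols (G'ᵀ * (F'ᵀ * M * S)) K'ᵀ) G'ᵀ (fromCols 1 0) 0)
    (V := fromBlocks (fromCols S 0) F (fromCols (-(S'ᵀ * M * S)) 1) (-(S'ᵀ * M * F)))
    (V' := fromBlocks (fromRows K (S'ᵀ * M)) (fromRows 0 1) G 0) ?_ ?_ ?_ ?_ ?_
  · have e : F'ᵀ * (G'ᵀ * (F'ᵀ * M * S)) = F'ᵀ * M * S := by
      rw [← Matrix.mul_assoc, t4, Matrix.one_mul]
    simp only [fromBlocks_multiply, fromRows_mul, mul_fromCols, t1, t2, t3, t4, e,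
      Matrix.mul_one, Matrix.zero_mul, Matrix.mul_zero, Matrix.neg_mul,
      show S'ᵀ * (G'ᵀ * (F'ᵀ * M * S)) = 0 by rw [← Matrix.mul_assoc, t3, Matrix.zero_mul]]
    ext ((i | i) | i) ((j | j) | j) <;> simp [one_apply]
  · simp [fromBlocks_multiply, fromCols_mul_fromRows, t5]
  · have e : -(S'ᵀ * M * S * K) + S'ᵀ * M + -(S'ᵀ * M * F * G) = 0 := by
      have : S'ᵀ * M * S * K + S'ᵀ * M * F * G = S'ᵀ * M := by
        rw [Matrix.mul_assoc _ S, Matrix.mul_assoc _ F, ← Matrix.mul_add, h5, Matrix.mul_one]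
      nth_rewrite 2 [← this]
      abel
    simp [fromBlocks_multiply, fromCols_mul_fromRows, h5, e]
  · simp only [fromBlocks_multiply, fromRows_mul, mul_fromCols, h1, h2, h3, h4, Matrix.mul_assoc,
      Matrix.one_mul, Matrix.mul_one, Matrix.zero_mul, Matrix.mul_zero, Matrix.mul_neg]
    ext ((i | i) | i) ((j | j) | j) <;> simp [one_apply]
  · simp only [fromBlocks_multiply, fromRows_mul, mul_fromCols, h1, h2, t1, t2, Matrix.mul_assoc,
      Matrix.one_mul, Matrix.mul_one, Matrix.zero_mul, Matrix.mul_zero, Matrix.mul_neg,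
      Matrix.neg_mul, Matrix.add_mul]
    ext ((i | i) | i) ((j | j) | j) <;> simp [one_apply]

/-! ### Completion of bidiagonal matrices -/

section Bidiagonal

variable {R : Type*} [CommRing R]

/-- The bidiagonal matrix with entries `a i` in position `(i, i)` and `-b i` in position
`(i, i + 1)`. -/
def bidiagonal (p q : ℕ) (a b : ℕ → R) : Matrix (Fin p) (Fin q) R :=
  Matrix.of fun i j => if (j : ℕ) = i then a i else if (j : ℕ) = i + 1 then -b i else 0

/-- The entries of the vector spanning the kernel of `bidiagonal p (p + 1) a b`. -/
def bidiagonalKer (p : ℕ) (a b : ℕ → R) (c : ℕ) : R :=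
  (∏ i ∈ Finset.range c, a i) * ∏ i ∈ Finset.range (p - c), b (c + i)

theorem bidiagonalKer_self (p : ℕ) (a b : ℕ → R) :
    bidiagonalKer p a b p = ∏ i ∈ Finset.range p, a i := by
  simp [bidiagonalKer]

theorem bidiagonalKer_succ {p c : ℕ} (hc : c ≤ p) (a b : ℕ → R) :
    bidiagonalKer (p + 1) a b c = bidiagonalKer p a b c * b p := by
  obtain ⟨d, rfl⟩ := Nat.exists_eq_add_of_le hc
  have e1 : c + d + 1 - c = d + 1 := by omega
  have e2 : c + d - c = d := by omega
  simp only [bidiagonalKer, e1, e2, Finset.prod_range_succ, mul_assoc]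

/-- Both sides are `a 0 ⋯ a c * b c ⋯ b (p - 1)`. -/
theorem mul_bidiagonalKer {p c : ℕ} (hc : c < p) (a b : ℕ → R) :
    a c * bidiagonalKer p a b c = b c * bidiagonalKer p a b (c + 1) := by
  obtain ⟨d, rfl⟩ := Nat.exists_eq_add_of_lt hc
  have e1 : c + d + 1 - c = d + 1 := by omega
  have e2 : c + d + 1 - (c + 1) = d := by omega
  have e3 : ∀ i, c + 1 + i = c + (i + 1) := by omega
  simp only [bidiagonalKer, e1, e2, e3, Finset.prod_range_succ' _ d, Finset.prod_range_succ _ c,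
    add_zero]
  ac_rfl

/-- Enlarging `p` by one multiplies the old kernel entries by `b p` and appends `∏ a i`, which is
coprime to `b p`. The restriction `i ≤ j` matters: in the Lagrange pencils `a (i + 2)` and `b i` are
the same `γ`. -/
theorem exists_sum_mul_bidiagonalKer_eq_one (a b : ℕ → R) (p : ℕ)
    (h : ∀ i j, i ≤ j → j < p → IsCoprime (a i) (b j)) :
    ∃ g : ℕ → R, ∑ c ∈ Finset.range (p + 1), g c * bidiagonalKer p a b c = 1 := by
  induction p with
  | zero => exact ⟨1, by simp [bidiagonalKer]⟩
  | succ p ih =>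
    obtain ⟨g, hg⟩ := ih fun i j hij hj => h i j hij (by omega)
    have hcop : IsCoprime (∏ i ∈ Finset.range (p + 1), a i) (b p) :=
      IsCoprime.prod_left fun i hi => h i p (by simp at hi; omega) (by omega)
    obtain ⟨u, v, huv⟩ := hcop
    refine ⟨fun c => if c ≤ p then v * g c else u, ?_⟩
    rw [Finset.sum_range_succ, bidiagonalKer_self]
    have : ∑ c ∈ Finset.range (p + 1), (if c ≤ p then v * g c else u) *
        bidiagonalKer (p + 1) a b c = v * b p * 1 := by
      rw [← hg, Finset.mul_sum]
      refine Finset.sum_congr rfl fun c hc => ?_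
      have hc' : c ≤ p := by simp at hc; omega
      rw [if_pos hc', bidiagonalKer_succ hc']
      ring
    rw [this]
    simp only [add_le_iff_nonpos_right, nonpos_iff_eq_zero, one_ne_zero, if_false]
    linear_combination huv

theorem bidiagonal_mul_ker (p : ℕ) (a b : ℕ → R) :
    bidiagonal p (p + 1) a b *
      Matrix.of (fun (c : Fin (p + 1)) (_ : Fin 1) => bidiagonalKer p a b c) = 0 := by
  ext i j
  have h : ∀ c : Fin (p + 1), bidiagonal p (p + 1) a b i c * bidiagonalKer p a b c =
      (if c = i.castSucc then a i * bidiagonalKer p a b i else 0) -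
        if c = i.succ then b i * bidiagonalKer p a b (i + 1) else 0 := by
    intro c
    simp only [bidiagonal, Matrix.of_apply, Fin.ext_iff, Fin.val_castSucc, Fin.val_succ]
    split_ifs with h1 h2 h2
    · omega
    · simp [h1]
    · simp [h2]
    · simp
  simp only [Matrix.mul_apply, Matrix.of_apply, h, Finset.sum_sub_distrib, Finset.sum_ite_eq',
    Finset.mem_univ, if_true, Matrix.zero_apply]
  rw [mul_bidiagonalKer i.2, sub_self]

/-- Append the Bézout row `G` to `K` to get `T`. Let `E` be the identity with its last column
replaced by `F`. Both `E` and `T * E` are block triangular with determinant `∏ a i`; cancelling it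
in the domain gives `det T = 1`. -/
theorem hasUnimodularCompletion_bidiagonal [IsDomain R] {p q : ℕ} (hq : q = p + 1) (a b : ℕ → R)
    (ha : ∀ i < p, a i ≠ 0) (h : ∀ i j, i ≤ j → j < p → IsCoprime (a i) (b j)) :
    HasUnimodularCompletion (bidiagonal p q a b)
      (Matrix.of fun (c : Fin q) (_ : Fin 1) => bidiagonalKer p a b c) := by
  subst hq
  obtain ⟨g, hg⟩ := exists_sum_mul_bidiagonalKer_eq_one a b p h
  set K := bidiagonal p (p + 1) a b
  set F := Matrix.of fun (c : Fin (p + 1)) (_ : Fin 1) => bidiagonalKer p a b c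
  let G : Matrix (Fin 1) (Fin (p + 1)) R := Matrix.of fun _ c => g c
  have hKF : K * F = 0 := bidiagonal_mul_ker p a b
  have hGF : G * F = 1 := by
    ext i j
    rw [Subsingleton.elim i j, one_apply_eq, mul_apply, ← hg, Finset.sum_range]
    rfl
  let e : Fin p ⊕ Fin 1 ≃ Fin (p + 1) := finSumFinEquiv
  have hTF : fromRows K G * F = fromRows 0 1 := by rw [fromRows_mul, hKF, hGF]
  let T : Matrix (Fin p ⊕ Fin 1) (Fin p ⊕ Fin 1) R := (fromRows K G).submatrix id e
  let E : Matrix (Fin p ⊕ Fin 1) (Fin p ⊕ Fin 1) R :=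
    fromCols (fromRows 1 0) (F.submatrix e id)
  have hE : E.det = ∏ i ∈ Finset.range p, a i := by
    have : E = fromBlocks 1 (F.submatrix e id).toRows₁ 0 (F.submatrix e id).toRows₂ := by
      ext (i | i) (j | j) <;> simp [E]
    rw [this, det_fromBlocks_zero₂₁, det_one, one_mul, det_fin_one, ← bidiagonalKer_self p a b]
    simp [F, e]
  have hTE : (T * E).det = ∏ i ∈ Finset.range p, a i := by
    have hTF' : T * F.submatrix e id = fromRows 0 1 := by
      rw [submatrix_mul_equiv, hTF, submatrix_id_id]
    have hTI : T * (fromRows 1 0 : Matrix (Fin p ⊕ Fin 1) (Fin p) R) = T.toCols₁ := by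
      conv_lhs => rw [← fromCols_toCols T]
      rw [fromCols_mul_fromRows, Matrix.mul_one, Matrix.mul_zero, add_zero]
    have : T * E = fromBlocks T.toCols₁.toRows₁ 0 T.toCols₁.toRows₂ 1 := by
      rw [mul_fromCols, hTF', hTI, ← fromCols_fromRows_eq_fromBlocks, fromRows_toRows]
    rw [this, det_fromBlocks_zero₁₂, det_one, mul_one, det_of_isUpperTriangular, Finset.prod_range]
    · simp [T, K, e, bidiagonal]
    · intro i j hij
      have hij' : (j : ℕ) < i := hij
      simp only [T, K, e, bidiagonal, toRows₁_apply, toCols₁_apply, submatrix_apply, id_eq,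
        fromRows_apply_inl, of_apply, finSumFinEquiv_apply_left, Fin.val_castAdd]
      rw [if_neg (by omega), if_neg (by omega)]
  have hT : T.det = 1 := by
    rw [det_mul, hE] at hTE
    exact (mul_eq_right₀ (Finset.prod_ne_zero_iff.2 fun i hi => ha i (by simpa using hi))).1 hTE
  have hT1 : T * T⁻¹ = 1 := mul_nonsing_inv T (by rw [hT]; exact isUnit_one)
  have hT2 : T⁻¹ * T = 1 := nonsing_inv_mul T (by rw [hT]; exact isUnit_one)
  let W : Matrix (Fin (p + 1)) (Fin p ⊕ Fin 1) R := T⁻¹.submatrix e.symm id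
  have hW1 : fromRows K G * W = 1 := by
    rw [← hT1, ← submatrix_id_id (fromRows K G * W), ← submatrix_mul_equiv _ _ id e id]
    simp [T, W]
  have hW2 : W * fromRows K G = 1 := by
    have : W * fromRows K G = (T⁻¹ * T).submatrix e.symm e.symm := by
      rw [← submatrix_mul_equiv _ _ e.symm (Equiv.refl _) e.symm]
      simp [T, W]
    rw [this, hT2, submatrix_one_equiv]
  -- As `[K; G] * F = [0; 1]`, the last column of the inverse is `F` itself; the other columns serve
  -- as `S`.
  have hWF : W.toCols₂ = F := by
    have : W * (fromRows K G * F) = F := by rw [← Matrix.mul_assoc, hW2, Matrix.one_mul]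
    rw [hTF, ← fromCols_toCols W, fromCols_mul_fromRows] at this
    simpa using this
  rw [← fromCols_toCols W, hWF] at hW1 hW2
  rw [fromRows_mul_fromCols, ← fromBlocks_one, fromBlocks_inj] at hW1
  rw [fromCols_mul_fromRows] at hW2
  exact ⟨G, W.toCols₁, hW1.1, hKF, hW1.2.2.1, hGF, hW2⟩

end Bidiagonal

/-! ### Grades and reversals -/

section Reversal

theorem reflect_sum {ι : Type*} (s : Finset ι) (f : ι → ℂ[X]) (N : ℕ) :
    reflect N (∑ i ∈ s, f i) = ∑ i ∈ s, reflect N (f i) :=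
  map_sum (⟨⟨reflect N, reflect_zero⟩, fun f g => reflect_add f g N⟩ : ℂ[X] →+ ℂ[X]) f s

theorem natDegree_prod_le_card {ι : Type*} (s : Finset ι) (f : ι → ℂ[X])
    (hf : ∀ i, (f i).natDegree ≤ 1) : (∏ i ∈ s, f i).natDegree ≤ s.card :=
  (natDegree_prod_le s f).trans ((Finset.sum_le_sum fun i _ => hf i).trans (by simp))

theorem reflect_prod_range (f : ℕ → ℂ[X]) (hf : ∀ i, (f i).natDegree ≤ 1) (N : ℕ) :
    reflect N (∏ i ∈ Finset.range N, f i) = ∏ i ∈ Finset.range N, reflect 1 (f i) := by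
  induction N with
  | zero => simp
  | succ N ih =>
    rw [Finset.prod_range_succ, Finset.prod_range_succ, ← ih]
    exact reflect_mul _ _ (by simpa using natDegree_prod_le_card (Finset.range N) f hf) (hf N)

theorem HasGrade.natDegree_le {α β : Type*} {d : ℕ} {A : Matrix α β ℂ[X]} (h : HasGrade d A)
    (i : α) (j : β) : (A i j).natDegree ≤ d :=
  natDegree_le_of_degree_le (h i j)

theorem hasGrade_of_natDegree_le {α β : Type*} {d : ℕ} {A : Matrix α β ℂ[X]}
    (h : ∀ i j, (A i j).natDegree ≤ d) : HasGrade d A :=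
  fun i j => degree_le_of_natDegree_le (h i j)

theorem HasGrade.add {α β : Type*} {d : ℕ} {A B : Matrix α β ℂ[X]} (hA : HasGrade d A)
    (hB : HasGrade d B) : HasGrade d (A + B) :=
  fun i j => (degree_add_le _ _).trans (max_le (hA i j) (hB i j))

theorem HasGrade.mul {α β δ : Type*} [Fintype β] {a b : ℕ} {A : Matrix α β ℂ[X]}
    {B : Matrix β δ ℂ[X]} (hA : HasGrade a A) (hB : HasGrade b B) : HasGrade (a + b) (A * B) :=
  hasGrade_of_natDegree_le fun i j => natDegree_sum_le_of_forall_le _ _ fun l _ =>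
    natDegree_mul_le_of_le (hA.natDegree_le i l) (hB.natDegree_le l j)

theorem HasGrade.transpose {α β : Type*} {d : ℕ} {A : Matrix α β ℂ[X]} (hA : HasGrade d A) :
    HasGrade d Aᵀ :=
  fun i j => hA j i

theorem HasGrade.matrixRev {α β : Type*} {d : ℕ} {A : Matrix α β ℂ[X]} (hA : HasGrade d A) :
    HasGrade d (matrixRev d A) :=
  hasGrade_of_natDegree_le fun i j =>
    natDegree_reflect_le.trans (max_le le_rfl (hA.natDegree_le i j))

theorem hasGrade_map_C {α β : Type*} (A : Matrix α β ℂ) : HasGrade 0 (A.map C) :=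
  fun _ _ => degree_C_le

theorem hasGrade_fromBlocks {α β δ ε : Type*} {d : ℕ} {A : Matrix α β ℂ[X]} {B : Matrix α δ ℂ[X]}
    {A' : Matrix ε β ℂ[X]} {B' : Matrix ε δ ℂ[X]} (hA : HasGrade d A) (hB : HasGrade d B)
    (hA' : HasGrade d A') (hB' : HasGrade d B') : HasGrade d (fromBlocks A B A' B') := by
  rintro (i | i) (j | j)
  exacts [hA i j, hB i j, hA' i j, hB' i j]

theorem matrixRev_mul {α β δ : Type*} [Fintype β] {a b : ℕ} {A : Matrix α β ℂ[X]}
    {B : Matrix β δ ℂ[X]} (hA : HasGrade a A) (hB : HasGrade b B) :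
    matrixRev (a + b) (A * B) = matrixRev a A * matrixRev b B := by
  ext1 i j
  simp only [matrixRev, map_apply, mul_apply, reflect_sum]
  exact Finset.sum_congr rfl fun l _ => reflect_mul _ _ (hA.natDegree_le i l) (hB.natDegree_le l j)

end Reversal

/-! ### Block kernels and their reversals -/

section Kernel

/-- The block column of multiples of the identity that spans the kernel of
`bidiagonal p q a b ⊗ₖ 1`, where `q = p + 1`. -/
def kernelBlock (p q n : ℕ) (a b : ℕ → ℂ[X]) : Matrix (Fin q × Fin n) (Fin n) ℂ[X] :=
  Matrix.of fun c j => bidiagonalKer p a b c.1 * (1 : Matrix (Fin n) (Fin n) ℂ[X]) c.2 j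

theorem hasUnimodularCompletion_kernelBlock {p q : ℕ} (n : ℕ) (hq : q = p + 1) (a b : ℕ → ℂ[X])
    (ha : ∀ i < p, a i ≠ 0) (h : ∀ i j, i ≤ j → j < p → IsCoprime (a i) (b j)) :
    HasUnimodularCompletion (bidiagonal p q a b ⊗ₖ (1 : Matrix (Fin n) (Fin n) ℂ[X]))
      (kernelBlock p q n a b) :=
  ((hasUnimodularCompletion_bidiagonal hq a b ha h).kronecker_one (Fin n)).reindex_right
    (Equiv.uniqueProd (Fin n) (Fin 1)).symm

variable {a b : ℕ → ℂ[X]}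

theorem natDegree_bidiagonalKer_le (ha : ∀ i, (a i).natDegree ≤ 1)
    (hb : ∀ i, (b i).natDegree ≤ 1) {p c : ℕ} (hc : c ≤ p) :
    (bidiagonalKer p a b c).natDegree ≤ p := by
  have h1 := natDegree_prod_le_card (Finset.range c) a ha
  have h2 := natDegree_prod_le_card (Finset.range (p - c)) (fun i => b (c + i)) fun i => hb _
  rw [Finset.card_range] at h1 h2
  exact (natDegree_mul_le_of_le h1 h2).trans (by omega)

/-- A kernel entry has `c + (p - c) = p` factors of grade 1, so reversal at grade `p` acts on each
factor. -/
theorem reflect_bidiagonalKer (ha : ∀ i, (a i).natDegree ≤ 1)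
    (hb : ∀ i, (b i).natDegree ≤ 1) {p c : ℕ} (hc : c ≤ p) :
    reflect p (bidiagonalKer p a b c) =
      bidiagonalKer p (fun i => reflect 1 (a i)) (fun i => reflect 1 (b i)) c := by
  have h1 := natDegree_prod_le_card (Finset.range c) a ha
  have h2 := natDegree_prod_le_card (Finset.range (p - c)) (fun i => b (c + i)) fun i => hb _
  rw [Finset.card_range] at h1 h2
  have h := reflect_mul _ _ h1 h2
  rw [reflect_prod_range _ ha, reflect_prod_range _ fun i => hb _, Nat.add_sub_cancel' hc] at h
  exact h

theorem hasGrade_kernelBlock (ha : ∀ i, (a i).natDegree ≤ 1) (hb : ∀ i, (b i).natDegree ≤ 1)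
    {p q : ℕ} (n : ℕ) (hq : q = p + 1) : HasGrade p (kernelBlock p q n a b) := by
  refine hasGrade_of_natDegree_le fun c j => ?_
  have := natDegree_bidiagonalKer_le ha hb (p := p) (c := c.1) (by omega)
  by_cases h : c.2 = j <;> simp [kernelBlock, one_apply, h, this]

theorem matrixRev_kernelBlock (ha : ∀ i, (a i).natDegree ≤ 1) (hb : ∀ i, (b i).natDegree ≤ 1)
    {p q : ℕ} (n : ℕ) (hq : q = p + 1) : matrixRev p (kernelBlock p q n a b) =
      kernelBlock p q n (fun i => reflect 1 (a i)) (fun i => reflect 1 (b i)) := by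
  ext1 c j
  have := reflect_bidiagonalKer ha hb (p := p) (c := c.1) (by omega)
  by_cases h : c.2 = j <;> simp [kernelBlock, matrixRev, one_apply, h, this]

theorem hasGrade_bidiagonal_kronecker (ha : ∀ i, (a i).natDegree ≤ 1)
    (hb : ∀ i, (b i).natDegree ≤ 1) (p q n : ℕ) :
    HasGrade 1 (bidiagonal p q a b ⊗ₖ (1 : Matrix (Fin n) (Fin n) ℂ[X])) := by
  refine hasGrade_of_natDegree_le fun ⟨i, i'⟩ ⟨j, j'⟩ => ?_
  by_cases h : i' = j'
  · simp only [kronecker_apply, h, one_apply_eq, mul_one, bidiagonal, of_apply]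
    split_ifs
    · exact ha _
    · rw [natDegree_neg]
      exact hb _
    · simp
  · simp [one_apply, h]

theorem matrixRev_bidiagonal_kronecker (a b : ℕ → ℂ[X]) (p q n : ℕ) :
    matrixRev 1 (bidiagonal p q a b ⊗ₖ (1 : Matrix (Fin n) (Fin n) ℂ[X])) =
      bidiagonal p q (fun i => reflect 1 (a i)) (fun i => reflect 1 (b i)) ⊗ₖ 1 := by
  ext1 ⟨i, i'⟩ ⟨j, j'⟩
  by_cases h : i' = j'
  · simp only [matrixRev, map_apply, kronecker_apply, h, one_apply_eq, mul_one, bidiagonal,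
      of_apply]
    split_ifs <;> simp
  · simp [matrixRev, one_apply, h]

end Kernel

/-! ### Linearization by Lagrange pencils with arbitrary body -/

namespace LagrangePencil

theorem natDegree_gam_le (x : ℕ → ℂ) (j : ℕ) : (gam x j).natDegree ≤ 1 :=
  natDegree_X_sub_C_le _

theorem reflect_gam (x : ℕ → ℂ) (j : ℕ) : reflect 1 (gam x j) = 1 - C (x j) * X := by
  simp [gam, reflect_sub]

theorem isCoprime_gam {x : ℕ → ℂ} {i j : ℕ} (h : x i ≠ x j) : IsCoprime (gam x i) (gam x j) :=
  isCoprime_X_sub_C_of_isUnit_sub (sub_ne_zero.2 h).isUnit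

theorem gam_ne_zero (x : ℕ → ℂ) (j : ℕ) : gam x j ≠ 0 :=
  X_sub_C_ne_zero _

/-- The Bézout identity is `x_i (1 - x_j λ) - x_j (1 - x_i λ) = x_i - x_j`; it also covers a node at
zero. -/
theorem isCoprime_reflect_gam {x : ℕ → ℂ} {i j : ℕ} (h : x i ≠ x j) :
    IsCoprime (reflect 1 (gam x i)) (reflect 1 (gam x j)) := by
  rw [reflect_gam, reflect_gam]
  have h' : C ((x i - x j)⁻¹) * (C (x i) - C (x j)) = 1 := by
    rw [← C_sub, ← C_mul, inv_mul_cancel₀ (sub_ne_zero.2 h), C_1]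
  exact ⟨-(C ((x i - x j)⁻¹) * C (x j)), C ((x i - x j)⁻¹) * C (x i), by linear_combination h'⟩

theorem reflect_gam_ne_zero (x : ℕ → ℂ) (j : ℕ) : reflect 1 (gam x j) ≠ 0 :=
  fun h => X_sub_C_ne_zero (x j) (reflect_eq_zero_iff.1 h)

/-- The kernel of `K₁`. -/
def kernel₁ (k μ n : ℕ) (x : ℕ → ℂ) : Matrix (Fin (k - μ) × Fin n) (Fin n) ℂ[X] :=
  kernelBlock (k - μ - 1) (k - μ) n (fun i => gam x (k + 1 - i)) (fun i => gam x (k - 1 - i))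

/-- The kernel of `K₂`. -/
def kernel₂ (μ m : ℕ) (x : ℕ → ℂ) : Matrix (Fin (μ + 1) × Fin m) (Fin m) ℂ[X] :=
  kernelBlock μ (μ + 1) m (fun i => gam x (μ + 2 - i)) (fun i => gam x (μ - i))

theorem K₁_eq (k μ n : ℕ) (x : ℕ → ℂ) : K₁ k μ n x =
    bidiagonal (k - μ - 1) (k - μ) (fun i => gam x (k + 1 - i)) (fun i => gam x (k - 1 - i)) ⊗ₖ 1 :=
  rfl

theorem K₂_eq (μ m : ℕ) (x : ℕ → ℂ) : K₂ μ m x =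
    bidiagonal μ (μ + 1) (fun i => gam x (μ + 2 - i)) (fun i => gam x (μ - i)) ⊗ₖ 1 :=
  rfl

theorem hasGrade_K₁ (k μ n : ℕ) (x : ℕ → ℂ) : HasGrade 1 (K₁ k μ n x) :=
  hasGrade_bidiagonal_kronecker (fun _ => natDegree_gam_le x _) (fun _ => natDegree_gam_le x _) _ _ _

theorem hasGrade_K₂ (μ m : ℕ) (x : ℕ → ℂ) : HasGrade 1 (K₂ μ m x) :=
  hasGrade_bidiagonal_kronecker (fun _ => natDegree_gam_le x _) (fun _ => natDegree_gam_le x _) _ _ _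

variable {m n k μ : ℕ} {x : ℕ → ℂ}

theorem node_ne (hx : Set.InjOn x (Set.Icc 1 (k + 1))) {i j : ℕ}
    (h : (1 ≤ i ∧ i ≤ k + 1) ∧ (1 ≤ j ∧ j ≤ k + 1) ∧ i ≠ j) : x i ≠ x j :=
  fun h' => h.2.2 (hx h.1 h.2.1 h')

theorem hasUnimodularCompletion_K₁ (hμ : μ < k) (hx : Set.InjOn x (Set.Icc 1 (k + 1))) :
    HasUnimodularCompletion (K₁ k μ n x) (kernel₁ k μ n x) := by
  rw [K₁_eq, kernel₁]
  exact hasUnimodularCompletion_kernelBlock n (by omega) _ _ (fun i _ => gam_ne_zero x _)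
    fun i j _ _ => isCoprime_gam (node_ne hx (by omega))

theorem hasUnimodularCompletion_K₂ (hμ : μ < k) (hx : Set.InjOn x (Set.Icc 1 (k + 1))) :
    HasUnimodularCompletion (K₂ μ m x) (kernel₂ μ m x) := by
  rw [K₂_eq, kernel₂]
  exact hasUnimodularCompletion_kernelBlock m rfl _ _ (fun i _ => gam_ne_zero x _)
    fun i j _ _ => isCoprime_gam (node_ne hx (by omega))

theorem hasUnimodularCompletion_matrixRev_K₁ (hμ : μ < k)
    (hx : Set.InjOn x (Set.Icc 1 (k + 1))) : HasUnimodularCompletion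
      (matrixRev 1 (K₁ k μ n x)) (matrixRev (k - μ - 1) (kernel₁ k μ n x)) := by
  rw [K₁_eq, kernel₁, matrixRev_bidiagonal_kronecker, matrixRev_kernelBlock
    (fun _ => natDegree_gam_le x _) (fun _ => natDegree_gam_le x _) n (by omega)]
  exact hasUnimodularCompletion_kernelBlock n (by omega) _ _ (fun i _ => reflect_gam_ne_zero x _)
    fun i j _ _ => isCoprime_reflect_gam (node_ne hx (by omega))

theorem hasUnimodularCompletion_matrixRev_K₂ (hμ : μ < k)
    (hx : Set.InjOn x (Set.Icc 1 (k + 1))) : HasUnimodularCompletion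
      (matrixRev 1 (K₂ μ m x)) (matrixRev μ (kernel₂ μ m x)) := by
  rw [K₂_eq, kernel₂, matrixRev_bidiagonal_kronecker, matrixRev_kernelBlock
    (fun _ => natDegree_gam_le x _) (fun _ => natDegree_gam_le x _) m rfl]
  exact hasUnimodularCompletion_kernelBlock m rfl _ _ (fun i _ => reflect_gam_ne_zero x _)
    fun i j _ _ => isCoprime_reflect_gam (node_ne hx (by omega))

/-- A pencil with body `M` linearizes the polynomial obtained by contracting `M` with the kernels
of `K₁` and `K₂`. -/
theorem isStrongLinearization_pencil (hμ : μ < k) (hx : Set.InjOn x (Set.Icc 1 (k + 1)))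
    {M : Matrix (Fin (μ + 1) × Fin m) (Fin (k - μ) × Fin n) ℂ[X]} (hM : HasGrade 1 M) :
    IsStrongLinearization k (pencil k μ x M) ((kernel₂ μ m x)ᵀ * M * kernel₁ k μ n x) := by
  have hF₁ : HasGrade (k - μ - 1) (kernel₁ k μ n x) := hasGrade_kernelBlock
    (fun _ => natDegree_gam_le x _) (fun _ => natDegree_gam_le x _) n (by omega)
  have hF₂ : HasGrade μ (kernel₂ μ m x)ᵀ := (hasGrade_kernelBlock
    (fun _ => natDegree_gam_le x _) (fun _ => natDegree_gam_le x _) m rfl).transpose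
  have hL : HasGrade 1 (pencil k μ x M) :=
    hasGrade_fromBlocks hM (hasGrade_K₂ μ m x).transpose (hasGrade_K₁ k μ n x)
      fun _ _ => by simp
  -- The grades of the second kernel, the body and the first kernel add up to exactly `k`.
  have hk : k = μ + 1 + (k - μ - 1) := by omega
  have hrev : matrixRev k ((kernel₂ μ m x)ᵀ * M * kernel₁ k μ n x) =
      (matrixRev μ (kernel₂ μ m x))ᵀ * matrixRev 1 M * matrixRev (k - μ - 1) (kernel₁ k μ n x) := by
    have h := matrixRev_mul (hF₂.mul hM) hF₁
    rw [matrixRev_mul hF₂ hM, ← hk] at h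
    exact h
  have hLrev : matrixRev 1 (pencil k μ x M) =
      fromBlocks (matrixRev 1 M) (matrixRev 1 (K₂ μ m x))ᵀ (matrixRev 1 (K₁ k μ n x)) 0 := by
    ext1 (i | i) (j | j) <;> simp [matrixRev, pencil]
  refine ⟨?_, ?_, ?_⟩
  · have := (hF₂.mul hM).mul hF₁
    rwa [← hk] at this
  · exact isLinearization_fromBlocks M (hasUnimodularCompletion_K₁ hμ hx)
      (hasUnimodularCompletion_K₂ hμ hx) hL
  · rw [hrev, hLrev]
    refine isLinearization_fromBlocks _ (hasUnimodularCompletion_matrixRev_K₁ hμ hx)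
      (hasUnimodularCompletion_matrixRev_K₂ hμ hx) ?_
    rw [← hLrev]
    exact hL.matrixRev

end LagrangePencil

/-! ### Contraction of the body to the barycentric polynomial -/

namespace LagrangePencil

section Contraction

variable {m n k μ : ℕ} {x : ℕ → ℂ}

/-- The diagonals are offset by two indices, so a kernel entry runs through consecutive factors `γ`
and skips exactly two neighbours. -/
theorem bidiagonalKer_gam_mul (x : ℕ → ℂ) {t p c : ℕ} (hc : c ≤ p) :
    bidiagonalKer p (fun i => gam x (t + 2 - i)) (fun i => gam x (t - i)) c *
      (gam x (t + 2 - c) * gam x (t + 1 - c)) = ∏ i ∈ Finset.range (p + 2), gam x (t + 2 - i) := by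
  obtain ⟨d, rfl⟩ := Nat.exists_eq_add_of_le hc
  induction d with
  | zero =>
    rw [add_zero, bidiagonalKer_self, Finset.prod_range_succ, Finset.prod_range_succ, mul_assoc]
    congr 3
    omega
  | succ d ih =>
    rw [← add_assoc, bidiagonalKer_succ (Nat.le_add_right c d), mul_right_comm,
      ih (Nat.le_add_right c d), Nat.add_right_comm _ 1 2, Finset.prod_range_succ _ (c + d + 2)]
    congr 2
    omega

theorem ell_eq_prod_range (k : ℕ) (x : ℕ → ℂ) :
    ell k x = ∏ i ∈ Finset.range (k + 1), gam x (k + 1 - i) := by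
  rw [ell, ← Finset.prod_range_reflect, ← Finset.Ico_succ_right_eq_Icc,
    Finset.prod_Ico_eq_prod_range]
  refine Finset.prod_congr rfl fun i hi => ?_
  rw [Finset.mem_range] at hi
  congr 1
  omega

/-- The splitting follows the shape of the body: the extra corner term, the first block row, and the
last block column below it. -/
theorem sum_Icc_eq {M : Type*} [AddCommMonoid M] (hμ : μ < k) (f : ℕ → M) :
    ∑ i ∈ Finset.Icc 1 (k + 1), f i = f (k + 1) + ∑ c ∈ Finset.range (k - μ), f (k - c) +
      ∑ r ∈ Finset.range μ, f (μ - r) := by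
  have h : ∑ i ∈ Finset.Icc 1 (k + 1), f i = ∑ i ∈ Finset.range (k + 1), f (k + 1 - i) := by
    rw [← Finset.sum_range_reflect, ← Finset.Ico_succ_right_eq_Icc,
      Finset.sum_Ico_eq_sum_range]
    refine Finset.sum_congr rfl fun i hi => ?_
    rw [Finset.mem_range] at hi
    congr 1
    omega
  obtain ⟨d, rfl⟩ := Nat.exists_eq_add_of_le hμ.le
  rw [h, Finset.sum_range_succ', add_comm _ (f (μ + d + 1 - 0)), add_assoc (f _)]
  have e : μ + d - μ = d := by omega
  rw [e, Nat.sub_zero]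
  congr 1
  rw [add_comm μ d, Finset.sum_range_add]
  congr 1 <;> refine Finset.sum_congr rfl fun i _ => ?_ <;> congr 1 <;> omega

theorem eq_ell_div_gam {i : ℕ} (hi : i ∈ Finset.Icc 1 (k + 1)) {q : ℂ[X]}
    (h : q * gam x i = ell k x) : q = ell k x / gam x i :=
  mul_right_cancel₀ (gam_ne_zero x i) (h.trans (ell_div_gam_mul k x hi).symm)

/-- The first entry of the second kernel is `γ_μ ⋯ γ_1`; the first kernel draws on `γ_{k+1}, …,
γ_{μ+1}` and skips two. -/
theorem ker_first_mul_ker (hμ : μ < k) {c : ℕ} (hc : c < k - μ) :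
    bidiagonalKer μ (fun i => gam x (μ + 2 - i)) (fun i => gam x (μ - i)) 0 *
      bidiagonalKer (k - μ - 1) (fun i => gam x (k + 1 - i)) (fun i => gam x (k - 1 - i)) c *
        (gam x (k + 1 - c) * gam x (k - c)) = ell k x := by
  obtain ⟨t, rfl⟩ : ∃ t, k = t + 1 := ⟨k - 1, by omega⟩
  have h := bidiagonalKer_gam_mul x (t := t) (p := t + 1 - μ - 1) (c := c) (by omega)
  rw [mul_assoc, show t + 1 + 1 = t + 2 from rfl, show t + 1 - 1 = t from rfl, h,
    ell_eq_prod_range]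
  have e : t + 1 + 1 = (t + 1 - μ - 1 + 2) + μ := by omega
  conv_rhs => rw [e, Finset.prod_range_add, mul_comm]
  congr 1
  · simp only [bidiagonalKer, Finset.range_zero, Finset.prod_empty, one_mul, Nat.sub_zero, zero_add]
    refine Finset.prod_congr rfl fun i _ => ?_
    congr 1
    omega
  · refine Finset.prod_congr rfl fun i _ => ?_
    congr 1
    omega

/-- The last entry of the first kernel is `γ_{k+1} ⋯ γ_{μ+3}`; the second kernel draws on `γ_{μ+2},
…, γ_1` and skips two. -/
theorem ker_mul_ker_last (hμ : μ < k) {r : ℕ} (hr : r ≤ μ) :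
    bidiagonalKer μ (fun i => gam x (μ + 2 - i)) (fun i => gam x (μ - i)) r *
      bidiagonalKer (k - μ - 1) (fun i => gam x (k + 1 - i)) (fun i => gam x (k - 1 - i))
        (k - μ - 1) * (gam x (μ + 2 - r) * gam x (μ + 1 - r)) = ell k x := by
  have e : k + 1 = (k - μ - 1) + (μ + 2) := by omega
  rw [mul_right_comm, bidiagonalKer_gam_mul x hr, bidiagonalKer_self, ell_eq_prod_range]
  conv_rhs => rw [e, Finset.prod_range_add, mul_comm]
  congr 1 <;> refine Finset.prod_congr rfl fun i _ => ?_ <;> congr 1 <;> omega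

theorem kernel_mul_mul_kernel_apply (M : Matrix (Fin (μ + 1) × Fin m) (Fin (k - μ) × Fin n) ℂ[X])
    (i : Fin m) (j : Fin n) : ((kernel₂ μ m x)ᵀ * M * kernel₁ k μ n x) i j =
      ∑ r : Fin (μ + 1), ∑ c : Fin (k - μ),
        bidiagonalKer μ (fun i => gam x (μ + 2 - i)) (fun i => gam x (μ - i)) r *
          bidiagonalKer (k - μ - 1) (fun i => gam x (k + 1 - i)) (fun i => gam x (k - 1 - i)) c *
            M (r, i) (c, j) := by
  rw [Finset.sum_comm]
  simp only [mul_apply, transpose_apply, kernel₁, kernel₂, kernelBlock, of_apply, one_apply,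
    Fintype.sum_prod_type, mul_ite, mul_one, mul_zero, ite_mul, zero_mul, Finset.sum_ite_eq',
    Finset.sum_mul, Finset.mem_univ, if_true]
  refine Finset.sum_congr rfl fun c _ => Finset.sum_congr rfl fun r _ => by ring

theorem scaledCoeff_apply (P : ℕ → Matrix (Fin m) (Fin n) ℂ) (l : ℕ) (q : ℂ[X]) (i : Fin m)
    (j : Fin n) : scaledCoeff k x P l q i j = q * scaledCoeff k x P l 1 i j := by
  simp [scaledCoeff]

theorem kernel_mul_body_mul_kernel (hμ : μ < k) (P : ℕ → Matrix (Fin m) (Fin n) ℂ) :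
    (kernel₂ μ m x)ᵀ * body k μ x P * kernel₁ k μ n x = barycentricPoly k x P := by
  ext1 i j
  set g := bidiagonalKer μ (fun i => gam x (μ + 2 - i)) (fun i => gam x (μ - i)) with hg
  set f := bidiagonalKer (k - μ - 1) (fun i => gam x (k + 1 - i)) (fun i => gam x (k - 1 - i))
    with hf
  have hfirst : ∀ c < k - μ, g 0 * f c * gam x (k + 1 - c) = ell k x / gam x (k - c) :=
    fun c hc => eq_ell_div_gam (by simp; omega) (by rw [mul_assoc]; exact ker_first_mul_ker hμ hc)
  -- In the corner `γ_{k+1}` and `γ_k` are both missing, and restoring either one leaves a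
  -- barycentric term; hence that block carries two coefficients.
  have hfirst' : g 0 * f 0 * gam x k = ell k x / gam x (k + 1) :=
    eq_ell_div_gam (by simp) (by
      rw [mul_assoc, mul_comm (gam x k)]; exact ker_first_mul_ker (c := 0) hμ (by omega))
  have hlast : ∀ r < μ, g (r + 1) * f (k - μ - 1) * gam x (μ + 1 - r) = ell k x / gam x (μ - r) :=
    fun r hr => eq_ell_div_gam (by simp; omega) (by
      have := ker_mul_ker_last (x := x) (r := r + 1) hμ (by omega)
      rwa [← mul_assoc, show μ + 2 - (r + 1) = μ + 1 - r by omega,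
        show μ + 1 - (r + 1) = μ - r by omega] at this)
  rw [kernel_mul_mul_kernel_apply, ← hg, ← hf, barycentricPoly, sum_Icc_eq hμ, Fin.sum_univ_succ]
  simp only [Matrix.add_apply, Matrix.sum_apply]
  congr 1
  · have hrow : ∀ c : Fin (k - μ), g (0 : Fin (μ + 1)) * f c * body k μ x P (0, i) (c, j) =
        (if (c : ℕ) = 0 then scaledCoeff k x P (k + 1) (ell k x / gam x (k + 1)) i j else 0) +
          scaledCoeff k x P (k - c) (ell k x / gam x (k - c)) i j := by
      intro c
      rw [body, of_apply, bodyBlock, Fin.val_zero, if_pos rfl]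
      rw [scaledCoeff_apply P (k - c), ← hfirst c c.2]
      split_ifs with hc
      · rw [scaledCoeff_apply, ← hfirst', Matrix.add_apply, scaledCoeff_apply,
          scaledCoeff_apply P k, hc, Nat.sub_zero, Nat.sub_zero]
        ring
      · rw [scaledCoeff_apply]
        ring
    rw [Finset.sum_congr rfl fun c _ => hrow c, Finset.sum_add_distrib,
      Fin.sum_univ_eq_sum_range fun c =>
        if c = 0 then scaledCoeff k x P (k + 1) (ell k x / gam x (k + 1)) i j else 0,
      Fin.sum_univ_eq_sum_range fun c => scaledCoeff k x P (k - c) (ell k x / gam x (k - c)) i j,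
      Finset.sum_ite_eq', if_pos (by simp; omega)]
  · rw [Finset.sum_range]
    refine Finset.sum_congr rfl fun r _ => ?_
    -- Below the first block row only the last block column contributes.
    rw [Finset.sum_eq_single (⟨k - μ - 1, by omega⟩ : Fin (k - μ))]
    · rw [body, of_apply, bodyBlock, Fin.val_succ, if_neg (by omega), if_pos (by simp; omega),
        scaledCoeff_apply, scaledCoeff_apply P (μ - r), ← hlast r r.2,
        show μ + 1 - ((r : ℕ) + 1) = μ - r by omega, show μ + 2 - ((r : ℕ) + 1) = μ + 1 - r by omega]
      ring
    · intro c _ hc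
      have : (c : ℕ) + 1 ≠ k - μ := fun h => hc (Fin.ext (by simp; omega))
      rw [body, of_apply, bodyBlock, Fin.val_succ, if_neg (by omega), if_neg this]
      simp
    · simp

theorem natDegree_scaledCoeff_le (P : ℕ → Matrix (Fin m) (Fin n) ℂ) (l t : ℕ) (i : Fin m)
    (j : Fin n) : (scaledCoeff k x P l (gam x t) i j).natDegree ≤ 1 := by
  rw [scaledCoeff, Matrix.smul_apply, map_apply, smul_eq_mul]
  exact (natDegree_mul_C_le _ _).trans (natDegree_gam_le x t)

theorem hasGrade_body (k μ : ℕ) (x : ℕ → ℂ) (P : ℕ → Matrix (Fin m) (Fin n) ℂ) :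
    HasGrade 1 (body k μ x P) := by
  refine hasGrade_of_natDegree_le fun p q => ?_
  rw [body, of_apply, bodyBlock]
  split_ifs
  · exact natDegree_add_le_of_degree_le (natDegree_scaledCoeff_le ..) (natDegree_scaledCoeff_le ..)
  · exact natDegree_scaledCoeff_le ..
  · exact natDegree_scaledCoeff_le ..
  · simp

end Contraction

end LagrangePencil

/-! ### The strong linearization theorem -/

open LagrangePencil in
theorem mainTheorem2 (m n k μ : ℕ) (hμ : μ < k)
    (x : ℕ → ℂ) (hx : Set.InjOn x (Set.Icc 1 (k + 1)))
    (P : ℕ → Matrix (Fin m) (Fin n) ℂ) :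
    IsStrongLinearization k (pencil k μ x (body k μ x P)) (barycentricPoly k x P) ∧
    ∀ (A : Matrix (Fin (μ + 1) × Fin m) (Fin (k - μ - 1) × Fin n) ℂ)
      (B : Matrix (Fin μ × Fin m) (Fin (k - μ) × Fin n) ℂ),
      IsStrongLinearization k
        (pencil k μ x
          (body k μ x P + A.map C * K₁ k μ n x + (K₂ μ m x).transpose * B.map C))
        (barycentricPoly k x P) := by
  have hbody := hasGrade_body k μ x P
  refine ⟨?_, fun A B => ?_⟩
  · rw [← kernel_mul_body_mul_kernel hμ P]
    exact isStrongLinearization_pencil hμ hx hbody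
  · have h₁ : K₁ k μ n x * kernel₁ k μ n x = 0 := by
      obtain ⟨_, _, _, h, _⟩ := hasUnimodularCompletion_K₁ (n := n) hμ hx
      exact h
    have h₂ : (kernel₂ μ m x)ᵀ * (K₂ μ m x)ᵀ = 0 := by
      obtain ⟨_, _, _, h, _⟩ := hasUnimodularCompletion_K₂ (m := m) hμ hx
      rw [← transpose_mul, h, transpose_zero]
    -- The kernels annihilate both perturbations, so the contracted polynomial is unchanged.
    have hQ : (kernel₂ μ m x)ᵀ * (body k μ x P + A.map C * K₁ k μ n x + (K₂ μ m x)ᵀ * B.map C) *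
        kernel₁ k μ n x = barycentricPoly k x P := by
      rw [← kernel_mul_body_mul_kernel hμ P, Matrix.mul_add, Matrix.mul_add,
        ← Matrix.mul_assoc _ (K₂ μ m x)ᵀ, h₂, Matrix.zero_mul, add_zero, Matrix.add_mul,
        ← Matrix.mul_assoc _ (A.map C), Matrix.mul_assoc _ (K₁ k μ n x), h₁, Matrix.mul_zero,
        add_zero]
    rw [← hQ]
    refine isStrongLinearization_pencil hμ hx ((hbody.add ?_).add ?_)
    · exact (hasGrade_map_C A).mul (hasGrade_K₁ k μ n x)
    · exact (hasGrade_K₂ μ m x).transpose.mul (hasGrade_map_C B)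

end
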